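/- Let $I$ and $S$ be finite sets of students and schools. A problem $(P,\succ,q)$ consists of a strict linear preference $P_i$ of each student $i$ over $S\cup\{\emptyset\}$ (where $\emptyset$ is the outside option, and $s$ is acceptable to $i$ if $s\mathrel{P_i}\emptyset$), a strict linear priority order $\succ_s$ of each school $s$ over $I$, and a capacity $q_s\in\{0,1,2,\dots\}$ of each school. For $m\ge 1$ the truncation $P_i^m$ keeps the order of the schools and makes exactly the first $m$ acceptable schools of $P_i$ (or all of them, if there are at most $m$) acceptable. The constrained Gale--Shapley mechanism is $GS^m(P,\succ,q)=GS(P^m,\succ,q)$, where $GS$ is the outcome of the student-proposing deferred acceptance algorithm. A student $i$ is a blocking student of $\mu:I\to S\cup\{\emptyset\}$ at $(P,\succ,q)$ if there is a school $s$ with $s\mathrel{P_i}\mu(i)$ such that $|\mu^{-1}(s)|<q_s$ or $i\succ_s j$ for some $j$ with $\mu(j)=s$. Student $i$ is guaranteed her first choice $s$ if $s$ is the top-ranked element of $P_i$ and $i$ is among the $q_s$ students of highest priority at $s$. A school $s$ is competitive if at least $q_s$ students are guaranteed their first choice $s$. A profile of reports $P'$ is a Nash equilibrium of the game $(GS^m,P)$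 with semi-sophisticated students if the following hold for each student $i$. (a) If $i$ is guaranteed her first choice, or has at most $m$ acceptable schools under $P_i$, or finds only competitive schools acceptable under $P_i$, then $P'_i=P_i$. (b) Otherwise $i$ drops competitive schools and is truthful about the rest: the schools acceptable under $P'_i$ are acceptable under $P_i$ and are ordered by $P'_i$ as by $P_i$; every non-competitive school acceptable under $P_i$ is acceptable under $P'_i$; and she drops competitive schools as long as the constraint is binding, that is, either no competitive school is acceptable under $P'_i$, or at most $m$ schools are acceptable under $P'_i$. (In particular, she may drop all competitive schools.) Theorem. Let $k>\ell>1$. At every problem $(P,\succ,q)$, each of the games $(GS^\ell,P)$ and $(GS^k,P)$ with semi-sophisticated students has exactly one Nash equilibrium outcome, and the equilibrium outcome $GS^\ell(P',\succ,q)$ of the first has at least as many blocking students at $(P,\succ,q)$ as the equilibrium outcome $GS^k(P'',\succ,q)$ of the second. -/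

import Mathlib

namespace SchoolChoice

/-- A strict linear order; `r.rel x y` means that `x` is ranked strictly above `y`. -/
structure Ranking (α : Type*) where
  rel : α → α → Prop
  irrefl : ∀ x, ¬ rel x x
  trans : ∀ x y z, rel x y → rel y z → rel x z
  total : ∀ x y, x ≠ y → rel x y ∨ rel y x

/-- A preference over the schools (`some s`) and the outside option (`none`). -/
abbrev Pref (S : Type*) := Ranking (Option S)

/-- A school choice problem: the preferences of the students, the priority orders of the
schools over the students, and the capacities of the schools. -/
structure Problem (I S : Type*) where
  pref : I → Pref S
  prio : S → Ranking I
  cap : S → ℕ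

namespace Pref

variable {S : Type*}

/-- The school `s` is acceptable: it is ranked above the outside option. -/
def Acceptable (p : Pref S) (s : S) : Prop := p.rel (some s) none

/-- `s` is one of the first `k` acceptable schools. -/
def AmongTop (p : Pref S) (k : ℕ) (s : S) : Prop :=
  p.Acceptable s ∧ {t : S | p.rel (some t) (some s)}.ncard < k

/-- The relation of the truncation after the `k`-th acceptable school: the schools are ordered
as before and exactly the first `k` acceptable schools are above the outside option. -/
def truncateRel (p : Pref S) (k : ℕ) : Option S → Option S → Prop
  | some s, some t => p.rel (some s) (some t)
  | some s, none => p.AmongTop k s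
  | none, some t => ¬ p.AmongTop k t
  | none, none => False

theorem AmongTop.of_rel [Finite S] {p : Pref S} {k : ℕ} {s t : S} (h : p.AmongTop k t)
    (hst : p.rel (some s) (some t)) : p.AmongTop k s := by
  refine ⟨p.trans _ _ _ hst h.1, lt_of_le_of_lt ?_ h.2⟩
  exact Set.ncard_le_ncard (fun u hu => p.trans _ _ _ hu hst) (Set.toFinite _)

/-- The truncation of a preference after the `k`-th acceptable school (if any). -/
def truncate [Finite S] (p : Pref S) (k : ℕ) : Pref S where
  rel := p.truncateRel k
  irrefl := by
    rintro (_ | s)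
    · exact id
    · exact p.irrefl _
  trans := by
    rintro (_ | x) (_ | y) (_ | z) h₁ h₂ <;> simp only [truncateRel] at h₁ h₂ ⊢
    · exact h₁ h₂
    · exact fun hz => h₁ (hz.of_rel h₂)
    · rcases eq_or_ne x z with rfl | hne
      · exact absurd h₁ h₂
      · rcases p.total (some x) (some z) (by simpa using hne) with h | h
        · exact h
        · exact absurd (h₁.of_rel h) h₂
    · exact h₂.of_rel h₁
    · exact p.trans _ _ _ h₁ h₂
  total := by
    rintro (_ | x) (_ | y) hne <;> simp only [truncateRel]
    · exact absurd rfl hne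
    · exact (em _).symm
    · exact em _
    · exact p.total _ _ hne

open Classical in
/-- The most preferred acceptable school outside the set `R`; `none` if there is no such
school. -/
noncomputable def best (p : Pref S) (R : Set S) : Option S :=
  if h : ∃ s, s ∉ R ∧ p.Acceptable s ∧ ∀ t, t ∉ R → t ≠ s → p.rel (some s) (some t)
  then some h.choose else none

end Pref

namespace Problem

variable {I S : Type*}

/-- `E.rejected n i` is the set of schools that have rejected student `i` in the first `n` steps
of the student-proposing deferred acceptance algorithm. At every step each student applies (or
keeps her pending application) to her most preferred acceptable school that has not rejected her,
and each school `s` rejects all its applicants except the `cap s` of highest priority. -/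
noncomputable def rejected (E : Problem I S) : ℕ → I → Set S
  | 0, _ => ∅
  | n + 1, i => E.rejected n i ∪
      {s | (E.pref i).best (E.rejected n i) = some s ∧
        E.cap s ≤ {j | (E.pref j).best (E.rejected n j) = some s ∧ (E.prio s).rel j i}.ncard}

/-- The outcome of the student-proposing deferred acceptance (Gale-Shapley) algorithm. Every step
before the algorithm stops produces a new rejection of a student by a school, so that
`|I| * |S|` steps suffice. -/
noncomputable def GS (E : Problem I S) (i : I) : Option S :=
  (E.pref i).best (E.rejected (Nat.card I * Nat.card S) i)

/-- The same priorities and capacities, with the preferences replaced by the reports `P'`. -/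
def withPref (E : Problem I S) (P' : I → Pref S) : Problem I S := { E with pref := P' }

/-- The outcome of the constrained mechanism `GS^k` at the reports `P'`. -/
noncomputable def constrainedGS [Finite S] (E : Problem I S) (k : ℕ) (P' : I → Pref S) :
    I → Option S :=
  (E.withPref fun i => (P' i).truncate k).GS

/-- The pair `(i, s)` blocks `μ`. -/
def Blocks (E : Problem I S) (μ : I → Option S) (i : I) (s : S) : Prop :=
  (E.pref i).rel (some s) (μ i) ∧
    ((∃ j, μ j = some s ∧ (E.prio s).rel i j) ∨ {j | μ j = some s}.ncard < E.cap s)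

/-- The number of blocking students of `μ`. -/
noncomputable def numBlocking (E : Problem I S) (μ : I → Option S) : ℕ :=
  {i | ∃ s, E.Blocks μ i s}.ncard

/-- Student `i` is guaranteed her first choice `s`: she ranks `s` first (above all other schools
and the outside option) and is among the `cap s` students of highest priority at `s`. -/
def Guaranteed (E : Problem I S) (i : I) (s : S) : Prop :=
  (∀ x : Option S, x ≠ some s → (E.pref i).rel (some s) x) ∧
    {j | (E.prio s).rel j i}.ncard < E.cap s

/-- School `s` is competitive: at least `cap s` students are guaranteed their first choice `s`. -/
def Competitive (E : Problem I S) (s : S) : Prop :=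
  E.cap s ≤ {i | E.Guaranteed i s}.ncard

/-- The report `p` is obtained from the preference of student `i` by dropping competitive
schools: only competitive schools are dropped, no school is added, the listed schools are in their
true order, and dropping goes on as long as the constraint `k` is binding, that is, until no
competitive school is listed or at most `k` schools are listed. Dropping all competitive schools
is always permitted. -/
def DropsCompetitive (E : Problem I S) (k : ℕ) (i : I) (p : Pref S) : Prop :=
  (∀ s, p.Acceptable s → (E.pref i).Acceptable s) ∧
  (∀ s, (E.pref i).Acceptable s → ¬ E.Competitive s → p.Acceptable s) ∧
  (∀ s t, p.Acceptable s → p.Acceptable t →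
    (p.rel (some s) (some t) ↔ (E.pref i).rel (some s) (some t))) ∧
  ((∀ s, p.Acceptable s → ¬ E.Competitive s) ∨ {s | p.Acceptable s}.ncard ≤ k)

/-- The profile of reports `P'` is a Nash equilibrium of the game `(GS^k, P)` with
semi-sophisticated students. A student reports truthfully if she is guaranteed her first choice,
or has at most `k` acceptable schools, or finds only competitive schools acceptable. Every other
student drops competitive schools. -/
def IsSemiNash (E : Problem I S) (k : ℕ) (P' : I → Pref S) : Prop :=
  ∀ i,
    (((∃ s, E.Guaranteed i s) ∨ {s | (E.pref i).Acceptable s}.ncard ≤ k ∨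
        ∀ s, (E.pref i).Acceptable s → E.Competitive s) → P' i = E.pref i) ∧
    (¬ ((∃ s, E.Guaranteed i s) ∨ {s | (E.pref i).Acceptable s}.ncard ≤ k ∨
        ∀ s, (E.pref i).Acceptable s → E.Competitive s) → E.DropsCompetitive k i (P' i))

/-- `μ` is an equilibrium outcome of `GS^k` with semi-sophisticated students. -/
def IsSemiNashOutcome [Finite S] (E : Problem I S) (k : ℕ) (μ : I → Option S) : Prop :=
  ∃ P' : I → Pref S, E.IsSemiNash k P' ∧ μ = E.constrainedGS k P'

end Problem

end SchoolChoice

/-! A student guaranteed her first choice reports it first and is never rejected by it, since fewer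
than its capacity of students outrank her. Hence a competitive school is filled by guaranteed
students, all of whom outrank every student without a guarantee; to the latter it is hopeless,
listed or not. So each equilibrium outcome is the deferred acceptance outcome in which these
students drop all competitive schools before truncation (`IsSemiNash.constrainedGS_eq`), which gives
uniqueness.

To compare `l < k`, final rejections are treated as the least settled family
(`rejected_subset_of_settled`). Longer lists cause more rejections, so a school full above a student
stays so (`fullAbove_essentialReport_mono`), no school loses in number of students
(`ncard_essentialReport_mono`), and at least as many students are matched.

Blocking students are exactly the unmatched ones with an acceptable school not full above them. A
student who blocks only under `k` is matched under `l` and unmatched under `k`; a student matched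
only under `k` blocks only under `l`. There are at least as many of the latter kind, so blocking
cannot increase (`numBlocking_essentialReport_le`). -/

namespace SchoolChoice

/-! ### Counting in finite strict linear orders. -/

namespace Ranking

variable {α : Type*}

theorem asymm (r : Ranking α) {x y : α} (h : r.rel x y) : ¬ r.rel y x :=
  fun h' => r.irrefl _ (r.trans _ _ _ h h')

/-- The ranking by the values of `key`, smaller values first, with ties broken by `r`. -/
def lexBy (r : Ranking α) (key : α → ℕ) : Ranking α where
  rel x y := key x < key y ∨ key x = key y ∧ r.rel x y
  irrefl x h := by
    rcases h with h | h
    · exact lt_irrefl _ h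
    · exact r.irrefl _ h.2
  trans x y z h h' := by
    rcases h with h | h <;> rcases h' with h' | h'
    · exact Or.inl (h.trans h')
    · exact Or.inl (h'.1 ▸ h)
    · exact Or.inl (h.1 ▸ h')
    · exact Or.inr ⟨h.1.trans h'.1, r.trans _ _ _ h.2 h'.2⟩
  total x y hne := by
    rcases lt_trichotomy (key x) (key y) with h | h | h
    · exact Or.inl (Or.inl h)
    · exact (r.total x y hne).imp (fun h' => Or.inr ⟨h, h'⟩) fun h' => Or.inr ⟨h.symm, h'⟩
    · exact Or.inr (Or.inl h)

theorem exists_bot [Finite α] (r : Ranking α) {T : Set α} (hT : T.Nonempty) :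
    ∃ x ∈ T, ∀ y ∈ T, y ≠ x → r.rel y x := by
  have : IsTrans α (Function.swap r.rel) := ⟨fun _ _ _ h h' => r.trans _ _ _ h' h⟩
  have : Std.Irrefl (Function.swap r.rel) := ⟨fun x => r.irrefl x⟩
  have : IsTrans α r.rel := ⟨fun _ _ _ h h' => r.trans _ _ _ h h'⟩
  have hwf : WellFounded (Function.swap r.rel) := Finite.wellFounded_of_trans_of_irrefl _
  obtain ⟨x, hx, hmin⟩ := hwf.has_min T hT
  refine ⟨x, hx, fun y hy hne => ?_⟩
  exact (r.total y x hne).resolve_right (hmin y hy)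

/-- At least `c` elements of a set of size at least `c` have fewer than `c` elements of the set
above them. -/
theorem le_ncard_top [Finite α] (r : Ranking α) (c : ℕ) (X : Set α) (hc : c ≤ X.ncard) :
    c ≤ {x | x ∈ X ∧ {y | y ∈ X ∧ r.rel y x}.ncard < c}.ncard := by
  induction hn : X.ncard generalizing X with
  | zero => omega
  | succ n ih =>
    rcases Nat.eq_or_lt_of_le hc with heq | hlt
    · have : {x | x ∈ X ∧ {y | y ∈ X ∧ r.rel y x}.ncard < c} = X := by
        ext x
        refine ⟨fun h => h.1, fun hx => ⟨hx, ?_⟩⟩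
        rw [heq]
        refine Set.ncard_lt_ncard ⟨fun y hy => hy.1, fun h => ?_⟩ (Set.toFinite _)
        exact r.irrefl _ (h hx).2
      rw [this]; exact hc
    · have hne : X.Nonempty := by
        rw [← Set.ncard_pos (Set.toFinite _)]; omega
      -- The lowest element is above nothing, so removing it leaves the other counts unchanged.
      obtain ⟨x₀, hx₀, hbot⟩ := r.exists_bot hne
      have hcard : (X \ {x₀}).ncard = n := by
        rw [Set.ncard_sdiff_singleton_of_mem hx₀]; omega
      refine (ih (X \ {x₀}) (by omega) hcard).trans (Set.ncard_le_ncard ?_ (Set.toFinite _))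
      rintro x ⟨hx, hlt'⟩
      refine ⟨hx.1, lt_of_le_of_lt (Set.ncard_le_ncard ?_ (Set.toFinite _)) hlt'⟩
      rintro y ⟨hy, hyx⟩
      refine ⟨⟨hy, ?_⟩, hyx⟩
      rintro rfl
      exact r.asymm hyx (hbot x hx.1 hx.2)

theorem ncard_le_of_forall_above_lt [Finite α] (r : Ranking α) {c : ℕ} {X : Set α}
    (h : ∀ x ∈ X, {y | y ∈ X ∧ r.rel y x}.ncard < c) : X.ncard ≤ c := by
  rcases X.eq_empty_or_nonempty with rfl | hne
  · simp
  · obtain ⟨x, hx, hbot⟩ := r.exists_bot hne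
    have h1 : X \ {x} ⊆ {y | y ∈ X ∧ r.rel y x} := fun y hy => ⟨hy.1, hbot y hy.1 hy.2⟩
    have h2 := Set.ncard_le_ncard h1 (Set.toFinite _)
    rw [Set.ncard_sdiff_singleton_of_mem hx] at h2
    have := h x hx
    omega

end Ranking

/-! ### Best choices, truncation and dropping schools. -/

namespace Pref

variable {S : Type*}

theorem best_eq_some_iff (p : Pref S) (R : Set S) (s : S) :
    p.best R = some s ↔ s ∉ R ∧ p.Acceptable s ∧ ∀ t, p.rel (some t) (some s) → t ∈ R := by
  have key : ∀ s, (s ∉ R ∧ p.Acceptable s ∧ ∀ t, t ∉ R → t ≠ s → p.rel (some s) (some t)) ↔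
      (s ∉ R ∧ p.Acceptable s ∧ ∀ t, p.rel (some t) (some s) → t ∈ R) := by
    refine fun s => and_congr_right fun _ => and_congr_right fun _ => forall_congr' fun t => ?_
    constructor
    · intro h hts
      by_contra ht
      have hne : t ≠ s := by rintro rfl; exact p.irrefl _ hts
      exact p.asymm hts (h ht hne)
    · intro h ht hne
      exact (p.total (some s) (some t) (by simpa using hne.symm)).resolve_right
        fun hts => ht (h hts)
  rw [← key]
  unfold best
  constructor
  · intro h
    split_ifs at h with hex
    obtain rfl := Option.some.inj h
    exact hex.choose_spec
  · intro h
    have hex : ∃ s, s ∉ R ∧ p.Acceptable s ∧ ∀ t, t ∉ R → t ≠ s → p.rel (some s) (some t) :=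
      ⟨s, h⟩
    rw [dif_pos hex, Option.some_inj]
    by_contra hne
    exact p.asymm (h.2.2 _ hex.choose_spec.1 hne) (hex.choose_spec.2.2 _ h.1 (Ne.symm hne))

theorem best_eq_none_iff [Finite S] (p : Pref S) (R : Set S) :
    p.best R = none ↔ ∀ s, p.Acceptable s → s ∈ R := by
  constructor
  · intro h
    by_contra! hex
    -- In the reversed order, the bottom element is the most preferred school.
    let q : Ranking S :=
      { rel := fun s t => p.rel (some t) (some s)
        irrefl := fun s => p.irrefl _
        trans := fun _ _ _ h h' => p.trans _ _ _ h' h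
        total := fun s t hne => p.total _ _ (by simpa using hne.symm) }
    obtain ⟨s, hs, hbot⟩ := q.exists_bot (T := {s | p.Acceptable s ∧ s ∉ R}) hex
    have := (p.best_eq_some_iff R s).2 ⟨hs.2, hs.1, fun t hts => by
      by_contra ht
      have hta : p.Acceptable t := p.trans _ _ _ hts hs.1
      have hne : t ≠ s := by rintro rfl; exact p.irrefl _ hts
      exact p.asymm hts (hbot t ⟨hta, ht⟩ hne)⟩
    rw [h] at this
    cases this
  · intro h
    by_contra hne
    obtain ⟨s, hs⟩ := Option.ne_none_iff_exists'.1 hne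
    rw [best_eq_some_iff] at hs
    exact hs.1 (h s hs.2.1)

theorem best_truncate_eq_some_iff [Finite S] (p : Pref S) (m : ℕ) (R : Set S) (s : S) :
    (p.truncate m).best R = some s ↔
      s ∉ R ∧ p.AmongTop m s ∧ ∀ t, p.rel (some t) (some s) → t ∈ R :=
  best_eq_some_iff _ _ _

open Classical in
/-- A preference that ranks the acceptable schools outside `C` above the outside option, and the
outside option above all other schools, in the order of `p` within both groups. -/
noncomputable def drop (p : Pref S) (C : Set S) : Pref S :=
  p.lexBy fun x => x.elim 1 fun s => if p.Acceptable s ∧ s ∉ C then 0 else 2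

theorem drop_acceptable_iff (p : Pref S) (C : Set S) (s : S) :
    (p.drop C).Acceptable s ↔ p.Acceptable s ∧ s ∉ C := by
  change (_ < _ ∨ _ = _ ∧ _) ↔ _
  by_cases h : p.Acceptable s ∧ s ∉ C <;> simp [h]

theorem drop_rel_iff (p : Pref S) (C : Set S) {s t : S} (hs : (p.drop C).Acceptable s)
    (ht : (p.drop C).Acceptable t) :
    (p.drop C).rel (some s) (some t) ↔ p.rel (some s) (some t) := by
  rw [drop_acceptable_iff] at hs ht
  simp [drop, Ranking.lexBy, hs, ht]

theorem drop_rel_some_iff (p : Pref S) (C : Set S) {s t : S} (hs : (p.drop C).Acceptable s) :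
    (p.drop C).rel (some t) (some s) ↔ p.rel (some t) (some s) ∧ t ∉ C := by
  constructor
  · intro h
    have ht : (p.drop C).Acceptable t := (p.drop C).trans _ _ _ h hs
    exact ⟨(p.drop_rel_iff C ht hs).1 h, ((p.drop_acceptable_iff C t).1 ht).2⟩
  · rintro ⟨h, htC⟩
    have ht : (p.drop C).Acceptable t := (p.drop_acceptable_iff C t).2
      ⟨p.trans _ _ _ h ((p.drop_acceptable_iff C s).1 hs).1, htC⟩
    exact (p.drop_rel_iff C ht hs).2 h

theorem amongTop_of_ncard_le [Finite S] (p : Pref S) {m : ℕ}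
    (h : {s | p.Acceptable s}.ncard ≤ m) {s : S} (hs : p.Acceptable s) : p.AmongTop m s := by
  refine ⟨hs, lt_of_lt_of_le (Set.ncard_lt_ncard ⟨fun t ht => ?_, fun hsub => ?_⟩
    (Set.toFinite _)) h⟩
  · exact p.trans _ _ _ ht hs
  · exact p.irrefl _ (hsub hs)

/-- The choices from a truncated list do not depend on which schools of `C` are listed, if none of
them is available and either none of them is listed or the truncation is not binding. -/
theorem best_truncate_eq_drop [Finite S] {p q : Pref S} {C : Set S} {m : ℕ}
    (hsub : ∀ s, q.Acceptable s → p.Acceptable s)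
    (hsup : ∀ s, p.Acceptable s → s ∉ C → q.Acceptable s)
    (hord : ∀ s t, q.Acceptable s → q.Acceptable t →
      (q.rel (some s) (some t) ↔ p.rel (some s) (some t)))
    (hbind : (∀ s, q.Acceptable s → s ∉ C) ∨ {s | q.Acceptable s}.ncard ≤ m ∨
      ∀ s, p.Acceptable s → s ∈ C)
    {R : Set S} (hR : C ⊆ R) :
    (q.truncate m).best R = ((p.drop C).truncate m).best R := by
  have hacc : ∀ s, s ∉ C → (q.Acceptable s ↔ (p.drop C).Acceptable s) := fun s hs => by
    rw [drop_acceptable_iff]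
    exact ⟨fun h => ⟨hsub s h, hs⟩, fun h => hsup s h.1 hs⟩
  have habove : ∀ s t, s ∉ C → (p.drop C).Acceptable s →
      ((p.drop C).rel (some t) (some s) ↔ q.rel (some t) (some s) ∧ t ∉ C) := by
    intro s t hs hsa
    have hsq := (hacc s hs).2 hsa
    rw [drop_rel_some_iff _ _ hsa]
    refine and_congr_left fun ht => ⟨fun h => ?_, fun h => ?_⟩
    · have htq : q.Acceptable t := hsup t (p.trans _ _ _ h (hsub s hsq)) ht
      exact (hord _ _ htq hsq).2 h
    · exact (hord _ _ (q.trans _ _ _ h hsq) hsq).1 h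
  have htop : ∀ s, s ∉ C → (q.AmongTop m s ↔ (p.drop C).AmongTop m s) := by
    intro s hs
    -- If no school of `C` is listed, positions agree; if the list is short, neither truncation
    -- binds; if only `C` is acceptable, nothing outside it is listed.
    rcases hbind with h | h | h
    · unfold AmongTop
      rw [hacc s hs]
      refine and_congr_right fun hsa => ?_
      have hset : {t | (p.drop C).rel (some t) (some s)} = {t | q.rel (some t) (some s)} := by
        ext t
        exact (habove s t hs hsa).trans
          (and_iff_left_of_imp fun ht => h t (q.trans _ _ _ ht ((hacc s hs).2 hsa)))
      rw [hset]
    · have h' : {s | (p.drop C).Acceptable s}.ncard ≤ m := by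
        refine (Set.ncard_le_ncard (fun t ht => ?_) (Set.toFinite _)).trans h
        rw [Set.mem_ofPred_eq, drop_acceptable_iff] at ht
        exact hsup t ht.1 ht.2
      exact ⟨fun hq => amongTop_of_ncard_le _ h' ((hacc s hs).1 hq.1),
        fun hq => amongTop_of_ncard_le _ h ((hacc s hs).2 hq.1)⟩
    · exact ⟨fun hq => absurd (h s (hsub s hq.1)) hs,
        fun hq => absurd (h s ((drop_acceptable_iff _ _ _).1 hq.1).1) hs⟩
  ext s
  simp only [best_truncate_eq_some_iff]
  refine and_congr_right fun hsR => ?_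
  have hsC : s ∉ C := fun h => hsR (hR h)
  rw [htop s hsC]
  refine and_congr_right fun hs => forall_congr' fun t => ?_
  rw [habove s t hsC hs.1]
  by_cases ht : t ∈ C
  · simp [ht, hR ht]
  · simp [ht]

/-- A school that a short list has in reach remains in reach on a longer list, when more schools
have rejected the student. -/
theorem best_truncate_mono [Finite S] {p : Pref S} {l k : ℕ} (hlk : l ≤ k) {Y R : Set S}
    (hY : Y ⊆ R) {s : S} (hs : s ∉ R) (h : (p.truncate l).best Y = some s) :
    (p.truncate k).best R = some s := by
  rw [best_truncate_eq_some_iff] at h ⊢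
  exact ⟨hs, ⟨h.2.1.1, h.2.1.2.trans_le hlk⟩, fun t ht => hY (h.2.2 t ht)⟩

end Pref

/-! ### Deferred acceptance as the least settled family of rejections. -/

namespace Problem

variable {I S : Type*}

/-- School `s` has at least `cap s` students of higher priority than `i` at `μ`. -/
def FullAbove (E : Problem I S) (μ : I → Option S) (s : S) (i : I) : Prop :=
  E.cap s ≤ {j | μ j = some s ∧ (E.prio s).rel j i}.ncard

/-- The applications of the students, when student `i` has been rejected by the schools `X i`. -/
noncomputable def applications (E : Problem I S) (X : I → Set S) (i : I) : Option S :=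
  (E.pref i).best (X i)

/-- The rejections `X` call for no further rejection, and all of them are justified. -/
def Settled (E : Problem I S) (X : I → Set S) : Prop :=
  (∀ i s, E.applications X i = some s → ¬ E.FullAbove (E.applications X) s i) ∧
  ∀ i s, s ∈ X i → E.FullAbove (E.applications X) s i

/-- The rejections at the end of the deferred acceptance algorithm. -/
noncomputable def finalRejected (E : Problem I S) : I → Set S :=
  E.rejected (Nat.card I * Nat.card S)

theorem applications_finalRejected (E : Problem I S) :
    E.applications E.finalRejected = E.GS := rfl

theorem mem_rejected_succ (E : Problem I S) (n : ℕ) (i : I) (s : S) :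
    s ∈ E.rejected (n + 1) i ↔ s ∈ E.rejected n i ∨
      (E.applications (E.rejected n) i = some s ∧
        E.FullAbove (E.applications (E.rejected n)) s i) := Iff.rfl

theorem FullAbove.mono [Finite I] {E : Problem I S} {μ ν : I → Option S} {s : S} {i j : I}
    (h : E.FullAbove μ s j) (hji : j = i ∨ (E.prio s).rel j i)
    (hμν : ∀ a, μ a = some s → (E.prio s).rel a j → ν a = some s) : E.FullAbove ν s i := by
  refine le_trans h (Set.ncard_le_ncard ?_ (Set.toFinite _))
  rintro a ⟨ha, haj⟩
  refine ⟨hμν a ha haj, ?_⟩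
  rcases hji with rfl | hji
  · exact haj
  · exact (E.prio s).trans _ _ _ haj hji

/-- Rejections stay justified: the best `cap s` applicants of a school are not rejected and apply
there again at the next step. -/
theorem fullAbove_of_mem_rejected [Finite I] (E : Problem I S) (n : ℕ) (i : I) (s : S)
    (h : s ∈ E.rejected n i) : E.FullAbove (E.applications (E.rejected n)) s i := by
  induction n generalizing i s with
  | zero => exact absurd h (Set.notMem_empty _)
  | succ n ih =>
    have hfull : E.FullAbove (E.applications (E.rejected n)) s i := by
      rcases (E.mem_rejected_succ n i s).1 h with h | h
      · exact ih i s h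
      · exact h.2
    refine ((E.prio s).le_ncard_top _ _ hfull).trans (Set.ncard_le_ncard ?_ (Set.toFinite _))
    rintro j ⟨⟨hj, hji⟩, hlt⟩
    refine ⟨?_, hji⟩
    have hnot : ¬ E.FullAbove (E.applications (E.rejected n)) s j := by
      refine not_le.2 (lt_of_le_of_lt (Set.ncard_le_ncard ?_ (Set.toFinite _)) hlt)
      rintro a ⟨ha, haj⟩
      exact ⟨⟨ha, (E.prio s).trans _ _ _ haj hji⟩, haj⟩
    have heq : E.rejected (n + 1) j = E.rejected n j := by
      ext t
      rw [mem_rejected_succ]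
      refine or_iff_left ?_
      rintro ⟨ht, htf⟩
      obtain rfl : s = t := Option.some.inj (hj.symm.trans ht)
      exact hnot htf
    rw [← hj]
    simp only [applications, heq]

/-- Until the process is stationary, each step adds a pair in `I × S`, and there are only `|I| *
|S|` pairs. -/
theorem rejected_succ_finalStep [Finite I] [Finite S] (E : Problem I S) :
    E.rejected (Nat.card I * Nat.card S + 1) = E.rejected (Nat.card I * Nat.card S) := by
  let T : ℕ → Set (I × S) := fun n => {x | x.2 ∈ E.rejected n x.1}
  have hmono : ∀ n, T n ⊆ T (n + 1) := fun n x hx => Or.inl hx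
  have key : ∀ n, E.rejected (n + 1) = E.rejected n ∨ n + 1 ≤ (T (n + 1)).ncard := by
    intro n
    have grow : ∀ n, E.rejected (n + 1) ≠ E.rejected n → (T n).ncard < (T (n + 1)).ncard := by
      intro n hne
      refine Set.ncard_lt_ncard ⟨hmono n, fun hsub => hne ?_⟩ (Set.toFinite _)
      funext i
      ext s
      exact ⟨fun h => @hsub (i, s) h, fun h => Or.inl h⟩
    induction n with
    | zero =>
      refine or_iff_not_imp_left.2 fun hne => ?_
      have := grow 0 hne
      omega
    | succ n ih =>
      refine or_iff_not_imp_left.2 fun hne => ?_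
      have := grow (n + 1) hne
      have hne' : E.rejected (n + 1) ≠ E.rejected n := by
        intro h
        apply hne
        funext i
        ext s
        rw [mem_rejected_succ, h, ← mem_rejected_succ, h]
      have := ih.resolve_left hne'
      omega
  refine (key _).resolve_right fun h => ?_
  have := Set.ncard_le_card (T (Nat.card I * Nat.card S + 1))
  rw [Nat.card_prod] at this
  omega

theorem settled_finalRejected [Finite I] [Finite S] (E : Problem I S) :
    E.Settled E.finalRejected := by
  refine ⟨fun i s hs hf => ?_, fun i s h => E.fullAbove_of_mem_rejected _ i s h⟩
  have : s ∈ E.rejected (Nat.card I * Nat.card S + 1) i := Or.inr ⟨hs, hf⟩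
  rw [rejected_succ_finalStep] at this
  exact ((Pref.best_eq_some_iff _ _ _).1 hs).1 this

/-- If `s` rejects someone above `i`, that justified rejection already makes `s` full above `i`;
otherwise every student at `s` above `i` under `μ` still applies there. -/
theorem Settled.fullAbove_mono [Finite I] {E : Problem I S} {Q : I → Pref S} {X : I → Set S}
    (hX : (E.withPref Q).Settled X) {μ : I → Option S} {s : S}
    (hμ : ∀ j, μ j = some s → s ∉ X j → (E.withPref Q).applications X j = some s) {i : I}
    (h : E.FullAbove μ s i) : E.FullAbove ((E.withPref Q).applications X) s i := by
  by_cases hex : ∃ j, (E.prio s).rel j i ∧ s ∈ X j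
  · obtain ⟨j, hji, hj⟩ := hex
    have hfj : E.FullAbove ((E.withPref Q).applications X) s j := hX.2 j s hj
    exact hfj.mono (Or.inr hji) fun _ h _ => h
  · push Not at hex
    exact h.mono (Or.inl rfl) fun a ha hai => hμ a ha (hex a hai)

/-- The rejections of the algorithm are contained in every settled family of rejections. -/
theorem rejected_subset_of_settled [Finite I] {E : Problem I S} {P Q : I → Pref S}
    {X : I → Set S} (hX : (E.withPref Q).Settled X)
    (hPQ : ∀ i Y s, Y ⊆ X i → s ∉ X i → (P i).best Y = some s → (Q i).best (X i) = some s)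
    (n : ℕ) (i : I) : (E.withPref P).rejected n i ⊆ X i := by
  induction n generalizing i with
  | zero => exact Set.empty_subset _
  | succ n ih =>
    intro s hs
    rcases ((E.withPref P).mem_rejected_succ n i s).1 hs with hs | ⟨hs, hf⟩
    · exact ih i hs
    · by_contra hsX
      exact hX.1 i s (hPQ i _ s (ih i) hsX hs)
        (hX.fullAbove_mono (fun j hj hjX => hPQ j _ s (ih j) hjX hj) hf)

/-! ### Competitive schools are out of reach for students without a guarantee. -/

theorem Guaranteed.rel {E : Problem I S} {i : I} {s : S} (h : E.Guaranteed i s) :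
    (E.pref i).Acceptable s ∧ ∀ t, ¬ (E.pref i).rel (some t) (some s) := by
  refine ⟨h.1 none (by simp), fun t ht => ?_⟩
  by_cases hts : t = s
  · subst hts
    exact (E.pref i).irrefl _ ht
  · exact (E.pref i).asymm ht (h.1 (some t) (by simpa using hts))

theorem fullAbove_of_competitive [Finite I] {E : Problem I S} {μ : I → Option S}
    (hμ : ∀ j t, E.Guaranteed j t → μ j = some t) {s : S} (hs : E.Competitive s) {i : I}
    (hi : ∀ t, ¬ E.Guaranteed i t) : E.FullAbove μ s i := by
  refine le_trans hs (Set.ncard_le_ncard ?_ (Set.toFinite _))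
  intro j hj
  refine ⟨hμ j s hj, ?_⟩
  have hne : j ≠ i := by rintro rfl; exact hi s hj
  refine ((E.prio s).total j i hne).resolve_right fun hij => ?_
  -- If `i` outranked some guaranteed student, she would outrank the lowest one, `b`. Then `i` and
  -- the other guaranteed students would be at least `cap s` students above `b`, against her
  -- guarantee.
  obtain ⟨b, hb, hbot⟩ := (E.prio s).exists_bot (T := {i | E.Guaranteed i s}) ⟨j, hj⟩
  have hib : (E.prio s).rel i b := by
    by_cases hjb : j = b
    · exact hjb ▸ hij
    · exact (E.prio s).trans _ _ _ hij (hbot j hj hjb)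
  have hsub : insert i ({i | E.Guaranteed i s} \ {b}) ⊆ {a | (E.prio s).rel a b} := by
    rintro a (rfl | ha)
    · exact hib
    · exact hbot a ha.1 ha.2
  have hcard := Set.ncard_le_ncard hsub (Set.toFinite _)
  rw [Set.ncard_insert_of_notMem (fun h => hi s h.1) (Set.toFinite _),
    Set.ncard_sdiff_singleton_of_mem hb] at hcard
  have h1 : E.cap s ≤ {i | E.Guaranteed i s}.ncard := hs
  have h2 := hb.2
  omega

/-- The competitive schools, for a student who is not guaranteed her first choice. -/
def hopeless (E : Problem I S) (i : I) : Set S :=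
  {s | E.Competitive s ∧ ∀ t, ¬ E.Guaranteed i t}

/-- The reports `Q` rank the guaranteed first choices first. -/
def ListsGuaranteed (E : Problem I S) (Q : I → Pref S) : Prop :=
  ∀ i s, E.Guaranteed i s → (Q i).Acceptable s ∧ ∀ t, ¬ (Q i).rel (some t) (some s)

section Hopeless

variable [Finite I] {E : Problem I S} {Q : I → Pref S} {X : I → Set S}

theorem Settled.applications_of_guaranteed (hX : (E.withPref Q).Settled X)
    (hQ : E.ListsGuaranteed Q) {i : I} {s : S} (h : E.Guaranteed i s) :
    (E.withPref Q).applications X i = some s := by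
  refine (Pref.best_eq_some_iff _ _ _).2
    ⟨fun hs => ?_, (hQ i s h).1, fun t ht => absurd ht ((hQ i s h).2 t)⟩
  have h1 : E.cap s ≤ _ := hX.2 i s hs
  have h2 := h.2
  have h3 : {j | (E.withPref Q).applications X j = some s ∧ (E.prio s).rel j i}.ncard ≤
      {j | (E.prio s).rel j i}.ncard := Set.ncard_le_ncard (fun j hj => hj.2) (Set.toFinite _)
  exact absurd (h1.trans h3) (not_le.2 h2)

/-- Nobody holds a hopeless school, as it is full above her; so excluding these schools beforehand
changes no application. -/
theorem Settled.applications_union_hopeless [Finite S] (hX : (E.withPref Q).Settled X)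
    (hQ : E.ListsGuaranteed Q) :
    (E.withPref Q).applications (fun i => X i ∪ E.hopeless i) =
      (E.withPref Q).applications X := by
  funext i
  cases h : (E.withPref Q).applications X i with
  | none =>
    refine (Pref.best_eq_none_iff _ _).2 fun s hs => Or.inl ?_
    exact (Pref.best_eq_none_iff _ _).1 h s hs
  | some s =>
    have hs := (Pref.best_eq_some_iff _ _ _).1 h
    refine (Pref.best_eq_some_iff _ _ _).2 ⟨?_, hs.2.1, fun t ht => Or.inl (hs.2.2 t ht)⟩
    rintro (hsX | hsH)
    · exact hs.1 hsX
    · exact hX.1 i s h (fullAbove_of_competitive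
        (fun _ _ hj => hX.applications_of_guaranteed hQ hj) hsH.1 hsH.2)

theorem Settled.union_hopeless [Finite S] (hX : (E.withPref Q).Settled X)
    (hQ : E.ListsGuaranteed Q) : (E.withPref Q).Settled (fun i => X i ∪ E.hopeless i) := by
  unfold Settled
  rw [hX.applications_union_hopeless hQ]
  refine ⟨hX.1, fun i s hs => ?_⟩
  rcases hs with hs | hs
  · exact hX.2 i s hs
  · exact fullAbove_of_competitive
      (fun _ _ hj => hX.applications_of_guaranteed hQ hj) hs.1 hs.2

end Hopeless

/-- The final rejections of the reports `Q`, together with the hopeless schools. -/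
noncomputable def excluded (E : Problem I S) (Q : I → Pref S) (i : I) : Set S :=
  (E.withPref Q).finalRejected i ∪ E.hopeless i

section Excluded

variable [Finite I] [Finite S] {E : Problem I S} {P Q : I → Pref S}

theorem applications_excluded (hQ : E.ListsGuaranteed Q) :
    (E.withPref Q).applications (E.excluded Q) = (E.withPref Q).GS :=
  (settled_finalRejected _).applications_union_hopeless hQ

theorem settled_excluded (hQ : E.ListsGuaranteed Q) : (E.withPref Q).Settled (E.excluded Q) :=
  (settled_finalRejected _).union_hopeless hQ

theorem excluded_subset (hQ : E.ListsGuaranteed Q)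
    (hPQ : ∀ i Y s, Y ⊆ E.excluded Q i → s ∉ E.excluded Q i → (P i).best Y = some s →
      (Q i).best (E.excluded Q i) = some s) (i : I) : E.excluded P i ⊆ E.excluded Q i :=
  Set.union_subset (rejected_subset_of_settled (settled_excluded hQ) hPQ _ i)
    Set.subset_union_right

theorem excluded_subset_of_best_eq (hQ : E.ListsGuaranteed Q)
    (hPQ : ∀ i Y, E.hopeless i ⊆ Y → (P i).best Y = (Q i).best Y) (i : I) :
    E.excluded P i ⊆ E.excluded Q i := by
  refine excluded_subset hQ (fun i Y s hY hs h => ?_) i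
  rw [← hPQ i (E.excluded Q i) Set.subset_union_right]
  rw [Pref.best_eq_some_iff] at h ⊢
  exact ⟨hs, h.2.1, fun t ht => hY (h.2.2 t ht)⟩

/-- By minimality the excluded families of `P` and `Q` contain each other, so only choices made
after hopeless schools are removed matter. -/
theorem GS_eq_of_best_eq (hP : E.ListsGuaranteed P) (hQ : E.ListsGuaranteed Q)
    (hPQ : ∀ i Y, E.hopeless i ⊆ Y → (P i).best Y = (Q i).best Y) :
    (E.withPref P).GS = (E.withPref Q).GS := by
  have heq : E.excluded P = E.excluded Q := by
    funext i
    exact (excluded_subset_of_best_eq hQ hPQ i).antisymm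
      (excluded_subset_of_best_eq hP (fun i Y hY => (hPQ i Y hY).symm) i)
  rw [← applications_excluded hP, ← applications_excluded hQ, heq]
  funext i
  exact hPQ i _ Set.subset_union_right

end Excluded

/-! ### The canonical report and uniqueness of the equilibrium outcome. -/

open Classical in
/-- The preferences after every student who is not guaranteed her first choice has dropped all
competitive schools. -/
noncomputable def essentialPref (E : Problem I S) (i : I) : Pref S :=
  if ∃ s, E.Guaranteed i s then E.pref i else (E.pref i).drop {s | E.Competitive s}

theorem essentialPref_of_guaranteed {E : Problem I S} {i : I} {s : S} (h : E.Guaranteed i s) :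
    E.essentialPref i = E.pref i := if_pos ⟨s, h⟩

theorem essentialPref_of_not {E : Problem I S} {i : I} (h : ¬ ∃ s, E.Guaranteed i s) :
    E.essentialPref i = (E.pref i).drop {s | E.Competitive s} := if_neg h

theorem hopeless_of_not {E : Problem I S} {i : I} (h : ¬ ∃ s, E.Guaranteed i s) :
    E.hopeless i = {s | E.Competitive s} := by
  push Not at h
  ext s
  simp [hopeless, h]

theorem acceptable_of_essentialPref {E : Problem I S} {i : I} {s : S}
    (h : (E.essentialPref i).Acceptable s) : (E.pref i).Acceptable s := by
  by_cases hg : ∃ s, E.Guaranteed i s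
  · obtain ⟨t, ht⟩ := hg
    rwa [essentialPref_of_guaranteed ht] at h
  · rw [essentialPref_of_not hg, Pref.drop_acceptable_iff] at h
    exact h.1

theorem essentialPref_rel {E : Problem I S} {i : I} {s t : S}
    (ht : (E.essentialPref i).Acceptable t) (hs : s ∉ E.hopeless i)
    (hst : (E.pref i).rel (some s) (some t)) : (E.essentialPref i).rel (some s) (some t) := by
  by_cases hg : ∃ s, E.Guaranteed i s
  · obtain ⟨u, hu⟩ := hg
    rwa [essentialPref_of_guaranteed hu]
  · rw [hopeless_of_not hg] at hs
    rw [essentialPref_of_not hg] at ht ⊢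
    exact (Pref.drop_rel_some_iff _ _ ht).2 ⟨hst, hs⟩

/-- The reports that the mechanism uses when all hopeless schools are dropped. -/
noncomputable def essentialReport [Finite S] (E : Problem I S) (m : ℕ) (i : I) : Pref S :=
  (E.essentialPref i).truncate m

theorem listsGuaranteed_truncate [Finite S] {E : Problem I S} {Q : I → Pref S}
    (hQ : E.ListsGuaranteed Q) {m : ℕ} (hm : 0 < m) :
    E.ListsGuaranteed fun i => (Q i).truncate m := by
  intro i s h
  obtain ⟨h1, h2⟩ := hQ i s h
  refine ⟨⟨h1, ?_⟩, h2⟩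
  simpa [h2] using hm

theorem listsGuaranteed_essentialReport [Finite S] (E : Problem I S) {m : ℕ} (hm : 0 < m) :
    E.ListsGuaranteed (E.essentialReport m) := by
  refine listsGuaranteed_truncate (fun i s h => ?_) hm
  rw [essentialPref_of_guaranteed h]
  exact h.rel

theorem IsSemiNash.constrainedGS_eq [Finite I] [Finite S] {E : Problem I S} {m : ℕ}
    (hm : 0 < m) {P' : I → Pref S} (h : E.IsSemiNash m P') :
    E.constrainedGS m P' = (E.withPref (E.essentialReport m)).GS := by
  refine GS_eq_of_best_eq (listsGuaranteed_truncate (fun i s hs => ?_) hm)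
    (E.listsGuaranteed_essentialReport hm) fun i Y hY => ?_
  · rw [(h i).1 (Or.inl ⟨s, hs⟩)]
    exact hs.rel
  · by_cases hg : ∃ s, E.Guaranteed i s
    · obtain ⟨s, hs⟩ := hg
      rw [(h i).1 (Or.inl ⟨s, hs⟩), essentialReport, essentialPref_of_guaranteed hs]
    · rw [essentialReport, essentialPref_of_not hg]
      rw [hopeless_of_not hg] at hY
      by_cases hc : (∃ s, E.Guaranteed i s) ∨ {s | (E.pref i).Acceptable s}.ncard ≤ m ∨
          ∀ s, (E.pref i).Acceptable s → E.Competitive s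
      · rw [(h i).1 hc]
        -- A truthful report fits the same lemma: without a guarantee, the list is short or wholly
        -- competitive.
        exact Pref.best_truncate_eq_drop (fun _ h => h) (fun _ h _ => h)
          (fun _ _ _ _ => Iff.rfl) (Or.inr (hc.resolve_left hg)) hY
      · obtain ⟨h1, h2, h3, h4⟩ := (h i).2 hc
        exact Pref.best_truncate_eq_drop h1 h2 h3 (h4.imp_right Or.inl) hY

open Classical in
theorem exists_isSemiNash (E : Problem I S) (m : ℕ) : ∃ P', E.IsSemiNash m P' := by
  refine ⟨fun i => if (∃ s, E.Guaranteed i s) ∨ {s | (E.pref i).Acceptable s}.ncard ≤ m ∨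
        ∀ s, (E.pref i).Acceptable s → E.Competitive s then E.pref i
      else (E.pref i).drop {s | E.Competitive s}, fun i => ⟨fun h => if_pos h, fun h => ?_⟩⟩
  dsimp only
  rw [if_neg h]
  refine ⟨fun s hs => ((Pref.drop_acceptable_iff _ _ _).1 hs).1,
    fun s hs hc => (Pref.drop_acceptable_iff _ _ _).2 ⟨hs, hc⟩,
    fun s t hs ht => Pref.drop_rel_iff _ _ hs ht,
    Or.inl fun s hs => ((Pref.drop_acceptable_iff _ _ _).1 hs).2⟩

theorem isSemiNashOutcome_iff [Finite I] [Finite S] (E : Problem I S) {m : ℕ} (hm : 0 < m)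
    (μ : I → Option S) :
    E.IsSemiNashOutcome m μ ↔ μ = (E.withPref (E.essentialReport m)).GS := by
  constructor
  · rintro ⟨P', hP', rfl⟩
    exact hP'.constrainedGS_eq hm
  · rintro rfl
    obtain ⟨P', hP'⟩ := E.exists_isSemiNash m
    exact ⟨P', hP', (hP'.constrainedGS_eq hm).symm⟩

/-! ### Blocking students and the comparison of two constraints. -/

theorem Settled.ncard_le_cap [Finite I] {E : Problem I S} {X : I → Set S} (hX : E.Settled X)
    (s : S) : {j | E.applications X j = some s}.ncard ≤ E.cap s :=
  (E.prio s).ncard_le_of_forall_above_lt fun i hi => not_le.1 (hX.1 i s hi)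

theorem blocks_iff [Finite I] (E : Problem I S) {μ : I → Option S} {s : S}
    (hμ : {j | μ j = some s}.ncard ≤ E.cap s) (i : I) :
    E.Blocks μ i s ↔ (E.pref i).rel (some s) (μ i) ∧ ¬ E.FullAbove μ s i := by
  refine and_congr_right fun hrel => ⟨?_, fun hf => ?_⟩
  · rintro (⟨j, hj, hij⟩ | hlt) hf
    · refine absurd (hf.trans_lt (Set.ncard_lt_ncard (t := {j | μ j = some s})
        ⟨fun a ha => ha.1, fun hsub => ?_⟩ (Set.toFinite _))) (not_lt.2 hμ)
      exact (E.prio s).asymm hij (hsub hj).2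
    · exact absurd (hf.trans (Set.ncard_le_ncard (fun a ha => ha.1) (Set.toFinite _)))
        (not_le.2 hlt)
  · refine or_iff_not_imp_left.2 fun hno => lt_of_le_of_lt
      (Set.ncard_le_ncard ?_ (Set.toFinite _)) (not_le.1 hf)
    intro a ha
    refine ⟨ha, ?_⟩
    have hai : a ≠ i := by
      rintro rfl
      rw [Set.mem_ofPred_eq] at ha
      rw [ha] at hrel
      exact (E.pref a).irrefl _ hrel
    exact ((E.prio s).total a i hai).resolve_right fun h => hno ⟨a, ha, h⟩

section EssentialOutcome

variable [Finite I] [Finite S] (E : Problem I S)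

/-- The blocking students are unmatched students for whom some acceptable school has room. -/
theorem exists_blocks_essentialReport_iff {m : ℕ} (hm : 0 < m) (i : I) :
    (∃ s, E.Blocks (E.withPref (E.essentialReport m)).GS i s) ↔
      (E.withPref (E.essentialReport m)).GS i = none ∧
        ∃ s, (E.pref i).Acceptable s ∧
          ¬ E.FullAbove (E.withPref (E.essentialReport m)).GS s i := by
  have hG := E.listsGuaranteed_essentialReport hm
  have hX := settled_excluded hG
  have hcap := hX.ncard_le_cap
  have hjust := hX.2 i
  have happ := applications_excluded hG
  rw [happ] at hcap hjust
  simp only [E.blocks_iff (hcap _)]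
  constructor
  · rintro ⟨s, hrel, hf⟩
    have hsX : s ∉ E.excluded (E.essentialReport m) i := fun h => hf (hjust s h)
    cases h : (E.withPref (E.essentialReport m)).GS i with
    | none =>
      rw [h] at hrel
      exact ⟨rfl, s, hrel, hf⟩
    | some t =>
      rw [h] at hrel
      rw [← happ] at h
      obtain ⟨-, ht, habove⟩ := (Pref.best_truncate_eq_some_iff _ _ _ _).1 h
      -- A matched student cannot block: a preferred school that is not hopeless lies above her
      -- match in the essential preference, hence has rejected her.
      exact absurd (habove s (essentialPref_rel ht.1 (fun hs => hsX (Or.inr hs)) hrel)) hsX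
  · rintro ⟨h, s, hs, hf⟩
    rw [h]
    exact ⟨s, hs, hf⟩

variable {l k : ℕ}

theorem applications_essentialReport_mono (hl : 0 < l) (hlk : l < k) {i : I} {s : S}
    (hi : (E.withPref (E.essentialReport l)).GS i = some s)
    (hs : s ∉ E.excluded (E.essentialReport k) i) :
    (E.withPref (E.essentialReport k)).applications (E.excluded (E.essentialReport k)) i =
      some s := by
  rw [← applications_excluded (E.listsGuaranteed_essentialReport hl)] at hi
  refine Pref.best_truncate_mono hlk.le (excluded_subset
    (E.listsGuaranteed_essentialReport (hl.trans hlk)) (fun i Y s hY hs h => ?_) i) hs hi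
  exact Pref.best_truncate_mono hlk.le hY hs h

theorem fullAbove_essentialReport_mono (hl : 0 < l) (hlk : l < k) {s : S} {i : I}
    (h : E.FullAbove (E.withPref (E.essentialReport l)).GS s i) :
    E.FullAbove (E.withPref (E.essentialReport k)).GS s i := by
  have hG := E.listsGuaranteed_essentialReport (hl.trans hlk)
  rw [← applications_excluded hG]
  exact (settled_excluded hG).fullAbove_mono
    (fun j hj hs => E.applications_essentialReport_mono hl hlk hj hs) h

/-- Under `k`, either `s` is excluded for someone and is therefore full, or it is excluded for
nobody and keeps all its students from `l`. -/
theorem ncard_essentialReport_mono (hl : 0 < l) (hlk : l < k) (s : S) :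
    {i | (E.withPref (E.essentialReport l)).GS i = some s}.ncard ≤
      {i | (E.withPref (E.essentialReport k)).GS i = some s}.ncard := by
  have hG := E.listsGuaranteed_essentialReport (hl.trans hlk)
  have hcap := (settled_finalRejected (E.withPref (E.essentialReport l))).ncard_le_cap s
  rw [applications_finalRejected] at hcap
  rw [← applications_excluded hG]
  by_cases hex : ∃ i, s ∈ E.excluded (E.essentialReport k) i
  · obtain ⟨i, hi⟩ := hex
    have hf := (settled_excluded hG).2 i s hi
    exact hcap.trans (le_trans hf (Set.ncard_le_ncard (fun a ha => ha.1) (Set.toFinite _)))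
  · push Not at hex
    exact Set.ncard_le_ncard
      (fun i hi => E.applications_essentialReport_mono hl hlk hi (hex i)) (Set.toFinite _)

theorem ncard_matched_le {μ ν : I → Option S}
    (h : ∀ s, {i | μ i = some s}.ncard ≤ {i | ν i = some s}.ncard) :
    {i | μ i ≠ none}.ncard ≤ {i | ν i ≠ none}.ncard := by
  classical
  have := Fintype.ofFinite I
  have := Fintype.ofFinite S
  have key : ∀ μ : I → Option S, {i | μ i ≠ none}.ncard = ∑ s, {i | μ i = some s}.ncard := by
    intro μ
    simp only [Set.ncard_eq_toFinset_card', Set.toFinset_ofPred]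
    rw [← Finset.card_biUnion]
    · congr 1
      ext i
      simp [Option.ne_none_iff_exists']
    · intro s _ t _ hst
      rw [Function.onFun, Finset.disjoint_left]
      intro i hi hi'
      simp only [Finset.mem_filter, Finset.mem_univ, true_and] at hi hi'
      exact hst (Option.some.inj (hi.symm.trans hi'))
  rw [key, key]
  exact Finset.sum_le_sum fun s _ => h s

theorem numBlocking_essentialReport_le (hl : 0 < l) (hlk : l < k) :
    E.numBlocking (E.withPref (E.essentialReport k)).GS ≤
      E.numBlocking (E.withPref (E.essentialReport l)).GS := by
  have hmatched := ncard_matched_le (E.ncard_essentialReport_mono hl hlk)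
  have hfull : ∀ s i, _ → _ := fun s i => E.fullAbove_essentialReport_mono hl hlk (s := s) (i := i)
  have happ := applications_excluded (E.listsGuaranteed_essentialReport (hl.trans hlk))
  have hclosed := (settled_excluded (E.listsGuaranteed_essentialReport (hl.trans hlk))).1
  have hacc : ∀ i s, (E.withPref (E.essentialReport k)).GS i = some s →
      (E.pref i).Acceptable s := fun i s h =>
    acceptable_of_essentialPref ((Pref.best_truncate_eq_some_iff _ _ _ _).1 h).2.1.1
  rw [happ] at hclosed
  unfold numBlocking
  simp only [E.exists_blocks_essentialReport_iff hl,
    E.exists_blocks_essentialReport_iff (hl.trans hlk)]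
  set μ := (E.withPref (E.essentialReport l)).GS
  set ν := (E.withPref (E.essentialReport k)).GS
  set B : Set I := {i | μ i = none ∧ ∃ s, (E.pref i).Acceptable s ∧ ¬ E.FullAbove μ s i}
  set B' : Set I := {i | ν i = none ∧ ∃ s, (E.pref i).Acceptable s ∧ ¬ E.FullAbove ν s i}
  -- Common elements cancel, so it suffices to compare the set differences through two inclusions.
  rw [Set.ncard_le_ncard_iff_ncard_sdiff_le_ncard_sdiff] at hmatched ⊢
  refine (Set.ncard_le_ncard ?_ (Set.toFinite _)).trans
    (hmatched.trans (Set.ncard_le_ncard ?_ (Set.toFinite _)))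
  · rintro i ⟨⟨hν, s, hs, hf⟩, hB⟩
    refine ⟨fun hμ => hB ⟨hμ, s, hs, fun h => hf (hfull s i h)⟩, ?_⟩
    simpa using hν
  · rintro i ⟨hν, hμ⟩
    have hμ' : μ i = none := by simpa using hμ
    obtain ⟨s, hs⟩ := Option.ne_none_iff_exists'.1 hν
    -- The school `s` held under `k` is not full above `i` there, hence not under `l` either, so `i`
    -- blocks under `l`.
    exact ⟨⟨hμ', s, hacc i s hs, fun h => hclosed i s hs (hfull s i h)⟩, fun h => hν h.1⟩

end EssentialOutcome

end Problem

end SchoolChoice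

theorem mainTheorem9 {I S : Type*} [Finite I] [Finite S] (E : SchoolChoice.Problem I S)
    (k l : ℕ) (hl : 1 < l) (hlk : l < k) :
    (∃! μ : I → Option S, E.IsSemiNashOutcome l μ) ∧
    (∃! ν : I → Option S, E.IsSemiNashOutcome k ν) ∧
    ∀ μ ν : I → Option S, E.IsSemiNashOutcome l μ → E.IsSemiNashOutcome k ν →
      E.numBlocking ν ≤ E.numBlocking μ := by
  have hl' : 0 < l := by omega
  have hk' : 0 < k := by omega
  simp only [E.isSemiNashOutcome_iff hl', E.isSemiNashOutcome_iff hk']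
  refine ⟨existsUnique_eq, existsUnique_eq, ?_⟩
  rintro _ _ rfl rfl
  exact E.numBlocking_essentialReport_le hl' hlk
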